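/- Let $E$ be a (real) Banach lattice with norm dual $E'$, ordered by $f\le g$ if and only if $f(x)\le g(x)$ for all $x\ge 0$ in $E$. A sequence in a Banach lattice is disjoint if $|x_m|\wedge|x_n|=0$ whenever $m\ne n$. A bounded set $A\subset E$ is called a Dunford–Pettis set (respectively, an almost Dunford–Pettis set) if every weakly null sequence (respectively, every disjoint weakly null sequence) $(f_n)$ in $E'$ converges to zero uniformly on $A$, i.e. $\sup_{a\in A}|f_n(a)|\to 0$. If $(x_m)_{m\in\mathbb N}$ is a disjoint sequence in $E$ such that $\{x_m : m\in\mathbb N\}$ is an almost Dunford–Pettis set, then $\{x_m : m\in\mathbb N\}$ is a Dunford–Pettis set; moreover, for every weakly compact operator $T:E\to c_0$, the set $\{T(x_m): m\in\mathbb N\}$ is relatively (norm) compact in $c_0$. -/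

import Mathlib

open Filter Topology
open scoped ZeroAtInfty

section DualOrder

variable {E : Type*} [NormedAddCommGroup E] [NormedSpace ℝ E] [Lattice E]

/-- The canonical order of the norm dual `E'` of a Banach lattice `E`:
`f ≤ g` if and only if `f x ≤ g x` for every `x` in the positive cone of `E`. -/
def DualLE (f g : StrongDual ℝ E) : Prop :=
  ∀ x : E, 0 ≤ x → f x ≤ g x

/-- `F` is the modulus `|f| = f ⊔ (-f)` of `f` in the dual Banach lattice `E'`, that is, the least
upper bound of `f` and `-f` for the canonical order of `E'`. -/
structure IsDualModulus (f F : StrongDual ℝ E) : Prop where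
  le : DualLE f F
  neg_le : DualLE (-f) F
  least : ∀ G : StrongDual ℝ E, DualLE f G → DualLE (-f) G → DualLE F G

/-- `h` is the infimum `f ⊓ g` in the dual Banach lattice `E'`, that is, the greatest lower bound
of `f` and `g` for the canonical order of `E'`. -/
structure IsDualInf (f g h : StrongDual ℝ E) : Prop where
  le_left : DualLE h f
  le_right : DualLE h g
  greatest : ∀ k : StrongDual ℝ E, DualLE k f → DualLE k g → DualLE k h

/-- Disjointness in the dual Banach lattice `E'`: `|f| ⊓ |g| = 0`. -/
def DualDisjoint (f g : StrongDual ℝ E) : Prop :=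
  ∃ F G : StrongDual ℝ E, IsDualModulus f F ∧ IsDualModulus g G ∧ IsDualInf F G 0

end DualOrder

/-- A sequence in a Banach lattice is disjoint if its terms are pairwise disjoint:
`|x m| ⊓ |x n| = 0` for `m ≠ n`. -/
def IsDisjointSeq {E : Type*} [AddCommGroup E] [Lattice E] (x : ℕ → E) : Prop :=
  ∀ m n : ℕ, m ≠ n → |x m| ⊓ |x n| = 0

/-- A sequence in the dual Banach lattice `E'` is disjoint if its terms are pairwise disjoint. -/
def IsDualDisjointSeq {E : Type*} [NormedAddCommGroup E] [NormedSpace ℝ E] [Lattice E]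
    (f : ℕ → StrongDual ℝ E) : Prop :=
  ∀ m n : ℕ, m ≠ n → DualDisjoint (f m) (f n)

/-- A sequence in a normed space is weakly null if it converges to zero in the weak topology. -/
def IsWeaklyNull {X : Type*} [NormedAddCommGroup X] [NormedSpace ℝ X] (x : ℕ → X) : Prop :=
  Tendsto (fun n => toWeakSpace ℝ X (x n)) atTop (𝓝 0)

/-- A sequence of functionals converges to zero uniformly on the set `A`. -/
def ConvergesUniformlyToZeroOn {X : Type*} [NormedAddCommGroup X] [NormedSpace ℝ X]
    (f : ℕ → StrongDual ℝ X) (A : Set X) : Prop :=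
  TendstoUniformlyOn (fun n x => f n x) (fun _ => (0 : ℝ)) atTop A

/-- A bounded set `A` in a Banach space is Dunford–Pettis if every weakly null sequence in `X'`
converges to zero uniformly on `A`. -/
def IsDunfordPettisSet {X : Type*} [NormedAddCommGroup X] [NormedSpace ℝ X] (A : Set X) : Prop :=
  Bornology.IsBounded A ∧
    ∀ f : ℕ → StrongDual ℝ X, IsWeaklyNull f → ConvergesUniformlyToZeroOn f A

/-- A bounded set `A` in a Banach lattice is almost Dunford–Pettis if every disjoint weakly null
sequence in `E'` converges to zero uniformly on `A`. -/
def IsAlmostDunfordPettisSet {E : Type*} [NormedAddCommGroup E] [NormedSpace ℝ E] [Lattice E]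
    (A : Set E) : Prop :=
  Bornology.IsBounded A ∧
    ∀ f : ℕ → StrongDual ℝ E, IsDualDisjointSeq f → IsWeaklyNull f →
      ConvergesUniformlyToZeroOn f A

/-- A bounded operator is weakly compact if it maps the closed unit ball to a set whose closure in
the weak topology is weakly compact. -/
def IsWeaklyCompactOperator {X Y : Type*} [NormedAddCommGroup X] [NormedSpace ℝ X]
    [NormedAddCommGroup Y] [NormedSpace ℝ Y] (T : X →L[ℝ] Y) : Prop :=
  IsCompact (closure (toWeakSpace ℝ Y '' (T '' Metric.closedBall (0 : X) 1)))

/-! ### Disjoint elements and Riesz decomposition -/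

section LatticeOrderedGroup

variable {E : Type*} [AddCommGroup E] [Lattice E] [IsOrderedAddMonoid E]

/-! Each `w` in `E` carries a band projection on `E'`, `(P_w f)(x) = lim_j f(x ⊓ j|w|)` for `x ≥ 0`.
It satisfies `(P_w f)(w) = f w`, and disjoint elements of `E` carry disjoint bands. If a weakly null
`(f_n)` is not uniformly small on the `x_m`, then, since `f_n(x_m) → 0` for each `m`, both indices
can be thinned so that `|f_n(x_n)| ≥ ε`. The functionals `P_{x_n} f_n` are disjoint and take the
same values at `x_n`, so a contradiction follows once they are weakly null
(`isWeaklyNull_bandProj`).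

For `φ` in `E''` consider the matrix `φ(P_{x_k} f_n)`. Its rows are absolutely summable, and each
subseries `f ↦ ∑_{k ∈ e} φ(P_{x_k} f)` is again in `E''`, hence tends to zero along `(f_n)`. A Baire
argument over all `e` (`tendsto_diagonal_of_tendsto_subseries`) then makes the diagonal tend to
zero.

For weakly compact `T : E → c₀`, the coordinate functionals composed with `T` are weakly null in
`E'`. A Dunford–Pettis set thus has an image whose coordinates vanish uniformly at infinity, which
is compactness in `c₀`. -/

theorem add_inf_le_inf_add_inf {a b c : E} (ha : 0 ≤ a) (hb : 0 ≤ b) (hc : 0 ≤ c) :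
    (a + b) ⊓ c ≤ a ⊓ c + b ⊓ c := by
  rw [add_inf, inf_add, inf_add]
  refine le_inf (le_inf inf_le_left ?_) (le_inf ?_ ?_)
  · exact inf_le_right.trans (le_add_of_nonneg_right hb)
  · exact inf_le_right.trans (le_add_of_nonneg_left ha)
  · exact inf_le_right.trans (le_add_of_nonneg_right hc)

theorem nsmul_inf_eq_zero {p q : E} (hp : 0 ≤ p) (hq : 0 ≤ q) (h : p ⊓ q = 0) (i : ℕ) :
    (i • p) ⊓ q = 0 := by
  induction i with
  | zero => simpa using hq
  | succ i ih =>
    refine le_antisymm ?_ (le_inf (nsmul_nonneg hp _) hq)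
    rw [succ_nsmul]
    simpa [ih, h] using add_inf_le_inf_add_inf (nsmul_nonneg hp i) hp hq

theorem nsmul_inf_nsmul_eq_zero {p q : E} (hp : 0 ≤ p) (hq : 0 ≤ q) (h : p ⊓ q = 0) (i j : ℕ) :
    (i • p) ⊓ (j • q) = 0 := by
  have h1 := nsmul_inf_eq_zero hp hq h i
  rw [inf_comm] at h1 ⊢
  exact nsmul_inf_eq_zero hq (nsmul_nonneg hp i) h1 j

theorem sum_inf_eq_zero {ι : Type*} (s : Finset ι) (u : ι → E) (v : E) (hu : ∀ i, 0 ≤ u i)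
    (hv : 0 ≤ v) (h : ∀ i ∈ s, u i ⊓ v = 0) : (∑ i ∈ s, u i) ⊓ v = 0 := by
  classical
  induction s using Finset.induction_on with
  | empty => simpa using hv
  | insert a s ha ih =>
    have h1 := ih fun i hi => h i (Finset.mem_insert_of_mem hi)
    have h2 := h a (Finset.mem_insert_self a s)
    have h3 : 0 ≤ ∑ i ∈ s, u i := Finset.sum_nonneg fun i _ => hu i
    rw [Finset.sum_insert ha]
    refine le_antisymm ?_ (le_inf (add_nonneg (hu a) h3) hv)
    simpa [h1, h2] using add_inf_le_inf_add_inf (hu a) h3 hv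

/-- A sum of pairwise disjoint positive elements equals their supremum, because `a + b = a ⊓ b + a ⊔
b`. -/
theorem sum_le_of_pairwise_disjoint {ι : Type*} (s : Finset ι) (u : ι → E) {x : E} (hx : 0 ≤ x)
    (hu : ∀ i, 0 ≤ u i) (hux : ∀ i, u i ≤ x) (h : ∀ i j, i ≠ j → u i ⊓ u j = 0) :
    ∑ i ∈ s, u i ≤ x := by
  classical
  induction s using Finset.induction_on with
  | empty => simpa using hx
  | insert a s ha ih =>
    have h1 : (∑ i ∈ s, u i) ⊓ u a = 0 :=
      sum_inf_eq_zero s u (u a) hu (hu a) fun i hi => h i a (by rintro rfl; exact ha hi)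
    rw [Finset.sum_insert ha, add_comm, ← inf_add_sup, h1, zero_add]
    exact sup_le ih (hux a)

/-- The Riesz decomposition property. -/
theorem exists_add_of_abs_le_add {a b y : E} (ha : 0 ≤ a) (hb : 0 ≤ b) (hy : |y| ≤ a + b) :
    ∃ y₁ y₂, y₁ + y₂ = y ∧ |y₁| ≤ a ∧ |y₂| ≤ b := by
  obtain ⟨h1, h2⟩ := abs_le'.1 hy
  refine ⟨(y ⊓ a) ⊔ (-a), y - ((y ⊓ a) ⊔ (-a)), by abel, abs_le'.2 ⟨?_, ?_⟩, abs_le'.2 ⟨?_, ?_⟩⟩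
  · exact sup_le inf_le_right ((neg_nonpos.2 ha).trans ha)
  · rw [neg_le]; exact le_sup_right
  · rw [sub_le_comm]
    exact le_sup_of_le_left (le_inf (sub_le_self _ hb) (sub_le_iff_le_add.2 h1))
  · rw [neg_sub, sub_le_iff_le_add]
    refine sup_le (inf_le_left.trans (le_add_of_nonneg_left hb)) ?_
    have h3 := neg_le_iff_add_nonneg.1 h2
    rw [neg_le_iff_add_nonneg]
    convert! h3 using 1
    abel

end LatticeOrderedGroup

/-! ### Functionals on the positive cone and the modulus -/

section Dual

variable {E : Type*} [NormedAddCommGroup E] [NormedSpace ℝ E] [Lattice E]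
  [IsOrderedAddMonoid E] [HasSolidNorm E]

omit [NormedSpace ℝ E] in
theorem norm_le_norm_of_nonneg_of_le {a b : E} (ha : 0 ≤ a) (h : a ≤ b) : ‖a‖ ≤ ‖b‖ :=
  HasSolidNorm.solid (by rwa [abs_of_nonneg ha, abs_of_nonneg (ha.trans h)])

omit [NormedSpace ℝ E] in
theorem norm_posPart_le (x : E) : ‖x⁺‖ ≤ ‖x‖ := by
  rw [← norm_abs_eq_norm x]
  refine norm_le_norm_of_nonneg_of_le (posPart_nonneg x) ?_
  rw [← posPart_add_negPart]; exact le_add_of_nonneg_right (negPart_nonneg x)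

omit [NormedSpace ℝ E] in
theorem norm_negPart_le (x : E) : ‖x⁻‖ ≤ ‖x‖ := by
  rw [← norm_abs_eq_norm x]
  refine norm_le_norm_of_nonneg_of_le (negPart_nonneg x) ?_
  rw [← posPart_add_negPart]; exact le_add_of_nonneg_left (posPart_nonneg x)

omit [HasSolidNorm E] in
theorem StrongDual.ext_of_nonneg {f g : StrongDual ℝ E} (h : ∀ x, 0 ≤ x → f x = g x) : f = g := by
  ext x
  rw [← posPart_sub_negPart x, map_sub, map_sub, h _ (posPart_nonneg x), h _ (negPart_nonneg x)]

theorem StrongDual.norm_le_of_nonneg {f : StrongDual ℝ E} {C : ℝ} (hC : 0 ≤ C)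
    (h : ∀ x, 0 ≤ x → |f x| ≤ C * ‖x‖) : ‖f‖ ≤ 2 * C := by
  refine f.opNorm_le_bound (by positivity) fun x => ?_
  have h1 := (h _ (posPart_nonneg x)).trans (mul_le_mul_of_nonneg_left (norm_posPart_le x) hC)
  have h2 := (h _ (negPart_nonneg x)).trans (mul_le_mul_of_nonneg_left (norm_negPart_le x) hC)
  have h3 : f x = f x⁺ - f x⁻ := by rw [← map_sub, posPart_sub_negPart]
  rw [h3, Real.norm_eq_abs]
  linarith [abs_sub (f x⁺) (f x⁻)]

/-- A bounded additive function on the positive cone extends to a continuous functional. -/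
theorem exists_strongDual_of_additive_on_cone (p : E → ℝ) (C : ℝ) (hC : 0 ≤ C)
    (hadd : ∀ x y, 0 ≤ x → 0 ≤ y → p (x + y) = p x + p y)
    (hbd : ∀ x, 0 ≤ x → |p x| ≤ C * ‖x‖) :
    ∃ F : StrongDual ℝ E, ∀ x, 0 ≤ x → F x = p x := by
  have key : ∀ x y : E, p (x + y)⁺ - p (x + y)⁻ = (p x⁺ - p x⁻) + (p y⁺ - p y⁻) := by
    intro x y
    -- Two decompositions of `x + y` into positive parts are compared with all terms moved to the
    -- cone, where `p` is additive.
    have e : x⁺ + y⁺ + (x + y)⁻ = (x + y)⁺ + (x⁻ + y⁻) := by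
      have h1 := posPart_sub_negPart x
      have h2 := posPart_sub_negPart y
      have h3 := posPart_sub_negPart (x + y)
      rw [← sub_eq_zero]
      have : x⁺ + y⁺ + (x + y)⁻ - ((x + y)⁺ + (x⁻ + y⁻))
        = (x⁺ - x⁻) + (y⁺ - y⁻) - ((x + y)⁺ - (x + y)⁻) := by abel
      rw [this, h1, h2, h3, sub_self]
    have e' := congrArg p e
    rw [hadd _ _ (add_nonneg (posPart_nonneg x) (posPart_nonneg y)) (negPart_nonneg _),
      hadd _ _ (posPart_nonneg x) (posPart_nonneg y),
      hadd _ _ (posPart_nonneg _) (add_nonneg (negPart_nonneg x) (negPart_nonneg y)),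
      hadd _ _ (negPart_nonneg x) (negPart_nonneg y)] at e'
    linarith
  have h0 : p 0 = 0 := by simpa using hadd 0 0 le_rfl le_rfl
  let A : E →+ ℝ := ⟨⟨fun x => p x⁺ - p x⁻, by simp⟩, key⟩
  have hA : ∀ x, A x = p x⁺ - p x⁻ := fun x => rfl
  have hc : Continuous A := by
    refine AddMonoidHomClass.continuous_of_bound A (2 * C) fun x => ?_
    have h1 := (hbd _ (posPart_nonneg x)).trans (mul_le_mul_of_nonneg_left (norm_posPart_le x) hC)
    have h2 := (hbd _ (negPart_nonneg x)).trans (mul_le_mul_of_nonneg_left (norm_negPart_le x) hC)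
    rw [hA, Real.norm_eq_abs]
    linarith [abs_sub (p x⁺) (p x⁻)]
  refine ⟨A.toRealLinearMap hc, fun x hx => ?_⟩
  have : A.toRealLinearMap hc x = p x⁺ - p x⁻ := rfl
  rw [this, posPart_of_nonneg hx, negPart_of_nonneg hx, h0, sub_zero]

/-- The Riesz–Kantorovich theorem: every continuous functional has a modulus. -/
theorem exists_isDualModulus (f : StrongDual ℝ E) :
    ∃ F : StrongDual ℝ E, IsDualModulus f F ∧ ∀ x, 0 ≤ x → ∀ y, |y| ≤ x → f y ≤ F x := by
  let S : E → Set ℝ := fun x => f '' {y | |y| ≤ x}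
  have hb : ∀ x y, |y| ≤ x → |f y| ≤ ‖f‖ * ‖x‖ := fun x y hy =>
    (f.le_opNorm y).trans (mul_le_mul_of_nonneg_left
      ((norm_abs_eq_norm y).symm.le.trans (norm_le_norm_of_nonneg_of_le (abs_nonneg y) hy))
      (norm_nonneg f))
  have hbdd : ∀ x, BddAbove (S x) := fun x =>
    ⟨‖f‖ * ‖x‖, by rintro _ ⟨y, hy, rfl⟩; exact (le_abs_self _).trans (hb x y hy)⟩
  have hne : ∀ x, 0 ≤ x → (S x).Nonempty := fun x hx => ⟨_, 0, by simpa using hx, rfl⟩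
  have hle : ∀ x y, |y| ≤ x → f y ≤ sSup (S x) := fun x y hy => le_csSup (hbdd x) ⟨y, hy, rfl⟩
  -- The modulus is `F x = sup {f y : |y| ≤ x}`; Riesz decomposition gives its subadditivity on the
  -- cone.
  obtain ⟨F, hF⟩ := exists_strongDual_of_additive_on_cone (fun x => sSup (S x)) ‖f‖ (norm_nonneg f)
    (by
      intro x y hx hy
      apply le_antisymm
      · refine csSup_le (hne _ (add_nonneg hx hy)) ?_
        rintro _ ⟨z, hz, rfl⟩
        obtain ⟨z₁, z₂, rfl, h1, h2⟩ := exists_add_of_abs_le_add hx hy hz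
        rw [map_add]
        exact add_le_add (hle _ _ h1) (hle _ _ h2)
      · rw [← le_sub_iff_add_le]
        refine csSup_le (hne _ hx) ?_
        rintro _ ⟨z, hz, rfl⟩
        rw [le_sub_comm]
        refine csSup_le (hne _ hy) ?_
        rintro _ ⟨t, ht, rfl⟩
        rw [le_sub_iff_add_le, ← map_add]
        refine hle _ _ ((abs_add_le _ _).trans ?_)
        rw [add_comm x y]
        exact add_le_add ht hz)
    (by
      intro x hx
      refine abs_le'.2 ⟨csSup_le (hne _ hx) ?_, ?_⟩
      · rintro _ ⟨y, hy, rfl⟩; exact (le_abs_self _).trans (hb x y hy)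
      · have h0 := hle x 0 (by simpa using hx)
        rw [map_zero] at h0
        linarith [mul_nonneg (norm_nonneg f) (norm_nonneg x)])
  refine ⟨F, ⟨fun x hx => ?_, fun x hx => ?_, fun G h1 h2 x hx => ?_⟩, fun x hx y hy => ?_⟩
  · rw [hF x hx]; exact hle _ _ (abs_of_nonneg hx).le
  · rw [hF x hx]
    have := hle x (-x) (by rw [abs_neg]; exact (abs_of_nonneg hx).le)
    simpa using this
  · rw [hF x hx]
    refine csSup_le (hne _ hx) ?_
    rintro _ ⟨y, hy, rfl⟩
    have e1 := h1 y⁺ (posPart_nonneg y)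
    have e2 := h2 y⁻ (negPart_nonneg y)
    have e3 : f y = f y⁺ - f y⁻ := by rw [← map_sub, posPart_sub_negPart]
    have e4 : G y⁺ + G y⁻ = G |y| := by rw [← map_add, posPart_add_negPart]
    have e5 : 0 ≤ G (x - |y|) := by
      have a1 := h1 _ (sub_nonneg.2 hy)
      have a2 := h2 _ (sub_nonneg.2 hy)
      rw [neg_apply] at a2
      linarith
    rw [neg_apply] at e2
    rw [map_sub] at e5
    linarith
  · rw [hF x hx]; exact hle _ _ hy

end Dual

/-! ### Band projections in the dual -/

section Band

variable {E : Type*} [NormedAddCommGroup E] [NormedSpace ℝ E] [Lattice E]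
  [IsOrderedAddMonoid E] [HasSolidNorm E]

omit [HasSolidNorm E] in
theorem StrongDual.mono_of_nonneg {F : StrongDual ℝ E} (hF : ∀ x, 0 ≤ x → 0 ≤ F x) {x y : E}
    (h : x ≤ y) : F x ≤ F y := by
  have := hF _ (sub_nonneg.2 h)
  rw [map_sub] at this
  linarith

omit [NormedSpace ℝ E] [HasSolidNorm E] in
theorem monotone_inf_nsmul_abs (w x : E) : Monotone fun j : ℕ => x ⊓ j • |w| := fun _ _ h =>
  inf_le_inf_left x (nsmul_le_nsmul_left (abs_nonneg w) h)

omit [HasSolidNorm E] in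
theorem exists_tendsto_inf_nsmul_of_nonneg {F : StrongDual ℝ E} (hF : ∀ x, 0 ≤ x → 0 ≤ F x)
    (w x : E) : ∃ l, Tendsto (fun j : ℕ => F (x ⊓ j • |w|)) atTop (𝓝 l) :=
  ⟨_, tendsto_atTop_ciSup
    (fun _ _ h => StrongDual.mono_of_nonneg hF (monotone_inf_nsmul_abs w x h))
    ⟨F x, by rintro _ ⟨j, rfl⟩; exact StrongDual.mono_of_nonneg hF inf_le_left⟩⟩

omit [HasSolidNorm E] in
theorem abs_apply_le_of_abs_le {f F : StrongDual ℝ E} (h : ∀ x, 0 ≤ x → ∀ y, |y| ≤ x → f y ≤ F x)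
    {x y : E} (hy : |y| ≤ x) : |f y| ≤ F x := by
  have hx := (abs_nonneg y).trans hy
  refine abs_le'.2 ⟨h x hx y hy, ?_⟩
  rw [← map_neg]
  exact h x hx _ (by rwa [abs_neg])

/-- The component of a functional in the band of functionals carried by `w`. -/
theorem exists_bandComponent (w : E) (f : StrongDual ℝ E) :
    ∃ g : StrongDual ℝ E, ∀ x, 0 ≤ x → Tendsto (fun j : ℕ => f (x ⊓ j • |w|)) atTop (𝓝 (g x)) := by
  obtain ⟨F, hF, hfF⟩ := exists_isDualModulus f
  have hF0 : ∀ x, 0 ≤ x → 0 ≤ F x := fun x hx => by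
    simpa using hfF x hx 0 (by simpa using hx)
  have hFf0 : ∀ x, 0 ≤ x → 0 ≤ (F - f) x := fun x hx => by
    have := hF.le x hx
    rw [sub_apply]; linarith
  -- Write `f = F - (F - f)`, a difference of positive functionals, along which the limits are
  -- monotone and bounded.
  have hlim : ∀ x, ∃ l, Tendsto (fun j : ℕ => f (x ⊓ j • |w|)) atTop (𝓝 l) := fun x => by
    obtain ⟨a, ha⟩ := exists_tendsto_inf_nsmul_of_nonneg hF0 w x
    obtain ⟨b, hb⟩ := exists_tendsto_inf_nsmul_of_nonneg hFf0 w x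
    exact ⟨a - b, (ha.sub hb).congr fun j => by simp⟩
  choose p hp using hlim
  have hnn : ∀ j : ℕ, 0 ≤ j • |w| := fun j => nsmul_nonneg (abs_nonneg w) j
  obtain ⟨g, hg⟩ := exists_strongDual_of_additive_on_cone p ‖f‖ (norm_nonneg f)
    (by
      intro x y hx hy
      refine tendsto_nhds_unique (hp (x + y)) ?_
      obtain ⟨a, ha⟩ := exists_tendsto_inf_nsmul_of_nonneg hF0 w (x + y)
      -- The additivity defect at stage `j` lies between `0` and `(x + y) ⊓ 2j|w| - (x + y) ⊓ j|w|`,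
      -- on which `F` tends to zero, both terms having the same limit.
      have h2 : Tendsto (fun j : ℕ => F ((x + y) ⊓ (2 * j) • |w|) - F ((x + y) ⊓ j • |w|))
          atTop (𝓝 0) := by
        have := (ha.comp (tendsto_id.const_mul_atTop' (r := 2) two_pos)).sub ha
        simpa using this
      have h3 : Tendsto (fun j : ℕ => f (x ⊓ j • |w| + y ⊓ j • |w| - (x + y) ⊓ j • |w|))
          atTop (𝓝 0) := by
        refine squeeze_zero_norm (fun j => ?_) h2
        rw [← map_sub]
        refine abs_apply_le_of_abs_le hfF ?_
        rw [abs_of_nonneg (sub_nonneg.2 (add_inf_le_inf_add_inf hx hy (hnn j)))]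
        refine sub_le_sub_right (le_inf (add_le_add inf_le_left inf_le_left) ?_) _
        rw [two_mul, add_smul]
        exact add_le_add inf_le_right inf_le_right
      have h4 := ((hp x).add (hp y)).sub h3
      rw [sub_zero] at h4
      refine h4.congr fun j => ?_
      rw [map_sub, map_add]; ring)
    (by
      intro x hx
      refine le_of_tendsto (hp x).abs (Eventually.of_forall fun j => ?_)
      refine (f.le_opNorm _).trans (mul_le_mul_of_nonneg_left ?_ (norm_nonneg f))
      exact norm_le_norm_of_nonneg_of_le (le_inf hx (hnn j)) inf_le_left)
  exact ⟨g, fun x hx => by rw [hg x hx]; exact hp x⟩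

/-- The band projection in the dual onto the band of functionals carried by `w`. -/
noncomputable def bandProj (w : E) (f : StrongDual ℝ E) : StrongDual ℝ E :=
  (exists_bandComponent w f).choose

theorem tendsto_bandProj (w : E) (f : StrongDual ℝ E) {x : E} (hx : 0 ≤ x) :
    Tendsto (fun j : ℕ => f (x ⊓ j • |w|)) atTop (𝓝 (bandProj w f x)) :=
  (exists_bandComponent w f).choose_spec x hx

theorem bandProj_add (w : E) (f g : StrongDual ℝ E) :
    bandProj w (f + g) = bandProj w f + bandProj w g :=
  StrongDual.ext_of_nonneg fun _ hx => tendsto_nhds_unique (tendsto_bandProj w (f + g) hx)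
    ((tendsto_bandProj w f hx).add (tendsto_bandProj w g hx))

theorem bandProj_smul (w : E) (c : ℝ) (f : StrongDual ℝ E) :
    bandProj w (c • f) = c • bandProj w f :=
  StrongDual.ext_of_nonneg fun _ hx => tendsto_nhds_unique (tendsto_bandProj w (c • f) hx)
    ((tendsto_bandProj w f hx).const_mul c)

theorem bandProj_neg (w : E) (f : StrongDual ℝ E) : bandProj w (-f) = -bandProj w f :=
  StrongDual.ext_of_nonneg fun _ hx =>
    tendsto_nhds_unique (tendsto_bandProj w (-f) hx) (tendsto_bandProj w f hx).neg

theorem bandProj_mono (w : E) {f g : StrongDual ℝ E} (h : DualLE f g) :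
    DualLE (bandProj w f) (bandProj w g) := fun _ hx =>
  le_of_tendsto_of_tendsto' (tendsto_bandProj w f hx) (tendsto_bandProj w g hx)
    fun j => h _ (le_inf hx (nsmul_nonneg (abs_nonneg w) j))

theorem bandProj_apply_of_le (w : E) (f : StrongDual ℝ E) {x : E} (hx : 0 ≤ x) {i : ℕ}
    (hi : x ≤ i • |w|) : bandProj w f x = f x := by
  refine tendsto_nhds_unique (tendsto_bandProj w f hx) (tendsto_const_nhds.congr' ?_)
  filter_upwards [eventually_ge_atTop i] with j hj
  rw [inf_eq_left.2 (hi.trans (nsmul_le_nsmul_left (abs_nonneg w) hj))]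

theorem bandProj_apply_self (w : E) (f : StrongDual ℝ E) : bandProj w f w = f w := by
  have h1 : w⁺ ≤ 1 • |w| := by
    rw [one_nsmul, ← posPart_add_negPart]; exact le_add_of_nonneg_right (negPart_nonneg w)
  have h2 : w⁻ ≤ 1 • |w| := by
    rw [one_nsmul, ← posPart_add_negPart]; exact le_add_of_nonneg_left (posPart_nonneg w)
  have h3 := bandProj_apply_of_le w f (posPart_nonneg w) h1
  have h4 := bandProj_apply_of_le w f (negPart_nonneg w) h2
  rw [← posPart_sub_negPart w, map_sub, map_sub, posPart_sub_negPart, h3, h4]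

theorem bandProj_apply_of_disjoint {v w : E} (hvw : |v| ⊓ |w| = 0) (f : StrongDual ℝ E) {x : E}
    (hx : 0 ≤ x) {i : ℕ} (hi : x ≤ i • |v|) : bandProj w f x = 0 := by
  refine tendsto_nhds_unique (tendsto_bandProj w f hx) (tendsto_const_nhds.congr fun j => ?_)
  have : x ⊓ j • |w| = 0 := by
    refine le_antisymm ?_ (le_inf hx (nsmul_nonneg (abs_nonneg w) j))
    rw [← nsmul_inf_nsmul_eq_zero (abs_nonneg v) (abs_nonneg w) hvw i j]
    exact inf_le_inf_right _ hi
  rw [this, map_zero]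

/-- Split `x` at `u = x ⊓ j|v|`: the band of `w` vanishes at `u`, and the band component of `F` at
`x - u` tends to zero with `j`. -/
theorem dualLE_zero_of_le_bandProj {v w : E} (hvw : |v| ⊓ |w| = 0) {F G k : StrongDual ℝ E}
    (hv : DualLE k (bandProj v F)) (hw : DualLE k (bandProj w G)) : DualLE k 0 := by
  intro x hx
  have h0 : Tendsto (fun j : ℕ => bandProj v F x - F (x ⊓ j • |v|)) atTop (𝓝 0) := by
    simpa using (tendsto_bandProj v F hx).const_sub (bandProj v F x)
  refine ge_of_tendsto' h0 fun j => ?_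
  have hu : 0 ≤ x ⊓ j • |v| := le_inf hx (nsmul_nonneg (abs_nonneg v) j)
  have h1 := hv _ (sub_nonneg.2 (inf_le_left : x ⊓ j • |v| ≤ x))
  have h2 := hw _ hu
  rw [bandProj_apply_of_disjoint hvw G hu inf_le_right] at h2
  rw [map_sub, map_sub, bandProj_apply_of_le v F hu inf_le_right] at h1
  linarith

/-- Positivity of the projection gives `|P_w f| ≤ P_w |f|`. -/
theorem exists_isDualModulus_bandProj (w : E) (f : StrongDual ℝ E) :
    ∃ F G : StrongDual ℝ E, IsDualModulus (bandProj w f) G ∧ DualLE 0 G ∧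
      DualLE G (bandProj w F) := by
  obtain ⟨F, hF, -⟩ := exists_isDualModulus f
  obtain ⟨G, hG, hG'⟩ := exists_isDualModulus (bandProj w f)
  refine ⟨F, G, hG, fun x hx => ?_, hG.least _ (bandProj_mono w hF.le) ?_⟩
  · simpa using hG' x hx 0 (by simpa using hx)
  · rw [← bandProj_neg]
    exact bandProj_mono w hF.neg_le

theorem dualDisjoint_bandProj {v w : E} (hvw : |v| ⊓ |w| = 0) (f g : StrongDual ℝ E) :
    DualDisjoint (bandProj v f) (bandProj w g) := by
  obtain ⟨F₁, F, hF, hF0, hFle⟩ := exists_isDualModulus_bandProj v f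
  obtain ⟨G₁, G, hG, hG0, hGle⟩ := exists_isDualModulus_bandProj w g
  exact ⟨F, G, hF, hG, hF0, hG0, fun k hkF hkG => dualLE_zero_of_le_bandProj hvw
    (fun x hx => (hkF x hx).trans (hFle x hx)) fun x hx => (hkG x hx).trans (hGle x hx)⟩

/-- For `y ≥ 0` the truncations `y ⊓ j|x k|` are disjoint with sum at most `y`, so any signed sum of
them has norm at most `‖y‖`. The factor 2 comes from passing from the cone to all of `E`. -/
theorem norm_sum_smul_bandProj_le {x : ℕ → E} (hx : IsDisjointSeq x) (f : StrongDual ℝ E)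
    (s : Finset ℕ) (c : ℕ → ℝ) (hc : ∀ k, c k = 1 ∨ c k = -1) :
    ‖∑ k ∈ s, c k • bandProj (x k) f‖ ≤ 2 * ‖f‖ := by
  refine StrongDual.norm_le_of_nonneg (norm_nonneg f) fun y hy => ?_
  have hlim : Tendsto (fun j : ℕ => f (∑ k ∈ s, c k • (y ⊓ j • |x k|))) atTop
      (𝓝 ((∑ k ∈ s, c k • bandProj (x k) f) y)) := by
    simp only [map_sum, map_smul, sum_apply, smul_apply]
    exact tendsto_finsetSum _ fun k _ => (tendsto_bandProj (x k) f hy).const_smul (c k)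
  refine le_of_tendsto hlim.abs (Eventually.of_forall fun j => ?_)
  refine (f.le_opNorm _).trans (mul_le_mul_of_nonneg_left ?_ (norm_nonneg f))
  have hu : ∀ k, 0 ≤ y ⊓ j • |x k| := fun k => le_inf hy (nsmul_nonneg (abs_nonneg _) j)
  have hsum : ∑ k ∈ s, y ⊓ j • |x k| ≤ y :=
    sum_le_of_pairwise_disjoint s (fun k => y ⊓ j • |x k|) hy hu (fun _ => inf_le_left)
      fun k l hkl => le_antisymm
        ((inf_le_inf inf_le_right inf_le_right).trans_eq
          (nsmul_inf_nsmul_eq_zero (abs_nonneg _) (abs_nonneg _) (hx k l hkl) j j))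
        (le_inf (hu k) (hu l))
  refine HasSolidNorm.solid ?_
  rw [abs_of_nonneg hy]
  refine (abs_le'.2 ⟨Finset.sum_le_sum fun k _ => ?_, ?_⟩).trans hsum
  · rcases hc k with h | h <;> rw [h]
    · rw [one_smul]
    · rw [neg_one_smul]; exact (neg_nonpos.2 (hu k)).trans (hu k)
  · rw [← Finset.sum_neg_distrib]
    refine Finset.sum_le_sum fun k _ => ?_
    rcases hc k with h | h <;> rw [h]
    · rw [one_smul]; exact (neg_nonpos.2 (hu k)).trans (hu k)
    · rw [neg_one_smul, neg_neg]

theorem sum_abs_apply_bandProj_le {x : ℕ → E} (hx : IsDisjointSeq x)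
    (φ : StrongDual ℝ (StrongDual ℝ E)) (f : StrongDual ℝ E) (s : Finset ℕ) :
    ∑ k ∈ s, |φ (bandProj (x k) f)| ≤ 2 * ‖φ‖ * ‖f‖ := by
  let c : ℕ → ℝ := fun k => if 0 ≤ φ (bandProj (x k) f) then 1 else -1
  have h1 : ∑ k ∈ s, |φ (bandProj (x k) f)| = φ (∑ k ∈ s, c k • bandProj (x k) f) := by
    rw [map_sum]
    refine Finset.sum_congr rfl fun k _ => ?_
    simp only [c, map_smul]
    split_ifs with h
    · rw [abs_of_nonneg h, one_smul]
    · rw [abs_of_neg (not_le.1 h), neg_one_smul]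
  rw [h1]
  have h2 := norm_sum_smul_bandProj_le hx f s c fun k => by
    simp only [c]; split_ifs <;> simp
  calc _ ≤ ‖φ‖ * ‖∑ k ∈ s, c k • bandProj (x k) f‖ := (le_abs_self _).trans (φ.le_opNorm _)
    _ ≤ ‖φ‖ * (2 * ‖f‖) := mul_le_mul_of_nonneg_left h2 φ.opNorm_nonneg
    _ = _ := by ring

theorem summable_abs_apply_bandProj {x : ℕ → E} (hx : IsDisjointSeq x)
    (φ : StrongDual ℝ (StrongDual ℝ E)) (f : StrongDual ℝ E) :
    Summable fun k => |φ (bandProj (x k) f)| :=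
  summable_of_sum_le (fun _ => abs_nonneg _) (sum_abs_apply_bandProj_le hx φ f)

theorem exists_subseries_functional {x : ℕ → E} (hx : IsDisjointSeq x)
    (φ : StrongDual ℝ (StrongDual ℝ E)) (e : ℕ → Bool) :
    ∃ ψ : StrongDual ℝ (StrongDual ℝ E),
      ∀ f, ψ f = ∑' k, if e k then φ (bandProj (x k) f) else 0 := by
  have hle : ∀ f k, ‖if e k then φ (bandProj (x k) f) else 0‖ ≤ |φ (bandProj (x k) f)| :=
    fun f k => by split_ifs <;> simp
  have hs : ∀ f, Summable fun k => if e k then φ (bandProj (x k) f) else 0 := fun f =>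
    (summable_abs_apply_bandProj hx φ f).of_norm_bounded (hle f)
  refine ⟨LinearMap.mkContinuous
    { toFun := fun f => ∑' k, if e k then φ (bandProj (x k) f) else 0
      map_add' := fun f g => ?_
      map_smul' := fun c f => ?_ } (2 * ‖φ‖) fun f => ?_, fun f => rfl⟩
  · rw [← (hs f).tsum_add (hs g)]
    refine tsum_congr fun k => ?_
    split_ifs <;> simp [bandProj_add]
  · rw [RingHom.id_apply, smul_eq_mul, ← tsum_mul_left]
    refine tsum_congr fun k => ?_
    split_ifs <;> simp [bandProj_smul]
  · exact (tsum_of_norm_bounded (summable_abs_apply_bandProj hx φ f).hasSum (hle f)).trans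
      ((summable_abs_apply_bandProj hx φ f).tsum_le_of_sum_le (sum_abs_apply_bandProj_le hx φ f))

end Band

/-! ### From subseries to the diagonal, by Baire category -/

theorem tendsto_diagonal_of_tendsto_subseries (a : ℕ → ℕ → ℝ) (hs : ∀ n, Summable (a n))
    (h : ∀ e : ℕ → Bool, Tendsto (fun n => ∑' k, if e k then a n k else 0) atTop (𝓝 0)) :
    Tendsto (fun n => a n n) atTop (𝓝 0) := by
  have hs' : ∀ n (e : ℕ → Bool), Summable fun k => if e k then a n k else 0 := fun n e =>
    ((hs n).abs).of_norm_bounded fun k => by split_ifs <;> simp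
  have hcont : ∀ n, Continuous fun e : ℕ → Bool => ∑' k, if e k then a n k else 0 := fun n => by
    refine continuous_tsum (u := fun k => |a n k|) (fun k => ?_) (hs n).abs fun k e => by
      split_ifs <;> simp
    exact (continuous_of_discreteTopology (f := fun b : Bool => if b then a n k else 0)).comp
      (continuous_apply k)
  rw [Metric.tendsto_atTop]
  intro ε hε
  -- By Baire on Cantor space, one `N` serves for a whole cylinder of index sets.
  obtain ⟨N, e, he⟩ := nonempty_interior_of_iUnion_of_closed
    (f := fun N : ℕ => {e : ℕ → Bool | ∀ n ≥ N, |∑' k, if e k then a n k else 0| ≤ ε / 3})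
    (fun N => by
      simp only [Set.ofPred_forall]
      exact isClosed_iInter fun n => isClosed_iInter fun _ =>
        isClosed_le (hcont n).abs continuous_const)
    (by
      refine Set.eq_univ_of_forall fun e => Set.mem_iUnion.2 ?_
      obtain ⟨N, hN⟩ := Metric.tendsto_atTop.1 (h e) (ε / 3) (by positivity)
      refine ⟨N, fun n hn => ?_⟩
      simpa [Real.dist_eq] using (hN n hn).le)
  obtain ⟨I, u, hu, hI⟩ := isOpen_pi_iff.1 isOpen_interior e he
  obtain ⟨M, hM⟩ := I.exists_nat_subset_range
  refine ⟨max N M, fun n hn => ?_⟩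
  have hnI : n ∉ I := fun hh =>
    absurd (Finset.mem_range.1 (hM hh)) (not_lt.2 ((le_max_right _ _).trans hn))
  -- For `n` outside `I` the cylinder leaves bit `n` free; flipping it changes the sum by exactly `a
  -- n n`, so `|a n n| ≤ 2ε/3`.
  have hmem : ∀ b, |∑' k, if Function.update e n b k then a n k else 0| ≤ ε / 3 := fun b => by
    refine interior_subset (hI ?_) n ((le_max_left _ _).trans hn)
    intro i hi
    rw [Function.update_of_ne (by rintro rfl; exact hnI hi)]
    exact (hu i hi).2
  have hdiff : (∑' k, if Function.update e n true k then a n k else 0) -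
      (∑' k, if Function.update e n false k then a n k else 0) = a n n := by
    rw [← (hs' n _).tsum_sub (hs' n _), tsum_eq_single n]
    · simp
    · intro k hk
      simp [Function.update_of_ne hk]
  rw [Real.dist_eq, sub_zero, ← hdiff]
  have h1 := abs_le.1 (hmem true)
  have h2 := abs_le.1 (hmem false)
  rw [abs_lt]
  constructor <;> linarith

/-- A basic neighbourhood of zero on which `f` is bounded contains the subspace of `y` vanishing on
a finite `I`; a functional bounded on a subspace vanishes there. -/
theorem exists_finset_forall_strongDual_pi (f : (ℕ → ℝ) →L[ℝ] ℝ) :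
    ∃ I : Finset ℕ, ∀ y, f y = ∑ i ∈ I, y i * f (Pi.single i 1) := by
  have hopen : IsOpen (f ⁻¹' Metric.ball 0 1) := Metric.isOpen_ball.preimage f.continuous
  obtain ⟨I, u, hu, hI⟩ := isOpen_pi_iff.1 hopen 0 (by simp)
  have hz : ∀ y : ℕ → ℝ, (∀ i ∈ I, y i = 0) → f y = 0 := by
    intro y hy
    by_contra hne
    have : (f y)⁻¹ • y ∈ f ⁻¹' Metric.ball 0 1 := hI fun i hi => by
      have := (hu i hi).2
      simpa [hy i hi] using this
    simp [hne] at this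
  refine ⟨I, fun y => ?_⟩
  have h := hz (y - ∑ i ∈ I, y i • Pi.single i 1) fun j hj => by
    simp [Finset.sum_apply, Pi.single_apply, hj]
  rw [map_sub, map_sum, sub_eq_zero] at h
  simpa using h

/-! ### Weakly null sequences and the Dunford–Pettis property -/

theorem isWeaklyNull_iff {X : Type*} [NormedAddCommGroup X] [NormedSpace ℝ X] (x : ℕ → X) :
    IsWeaklyNull x ↔ ∀ φ : StrongDual ℝ X, Tendsto (fun n => φ (x n)) atTop (𝓝 0) := by
  refine (WeakBilin.tendsto_iff_forall_eval_tendsto (topDualPairing ℝ X).flip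
    fun a b h => ?_).trans (forall_congr' fun φ => ?_)
  · refine (NormedSpace.inclusionInDoubleDualLi ℝ (E := X)).injective ?_
    ext φ
    exact LinearMap.congr_fun h φ
  · change Tendsto (fun n => φ (x n)) atTop (𝓝 (φ 0)) ↔ _
    rw [map_zero]

theorem isWeaklyNull_bandProj {E : Type*} [NormedAddCommGroup E] [NormedSpace ℝ E] [Lattice E]
    [IsOrderedAddMonoid E] [HasSolidNorm E] {x : ℕ → E} (hx : IsDisjointSeq x)
    {f : ℕ → StrongDual ℝ E} (hf : IsWeaklyNull f) :
    IsWeaklyNull fun n => bandProj (x n) (f n) := by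
  rw [isWeaklyNull_iff] at hf ⊢
  intro φ
  refine tendsto_diagonal_of_tendsto_subseries (fun n k => φ (bandProj (x k) (f n)))
    (fun n => (summable_abs_apply_bandProj hx φ (f n)).of_abs) fun e => ?_
  obtain ⟨ψ, hψ⟩ := exists_subseries_functional hx φ e
  exact (hf ψ).congr fun n => hψ (f n)

/-- Sequences of reals that converge to zero along the first index but not uniformly in the second
stay away from zero along a sequence of pairs increasing in both indices. -/
theorem exists_strictMono_of_not_tendstoUniformly {a : ℕ → ℕ → ℝ}
    (ha : ∀ m, Tendsto (fun n => a n m) atTop (𝓝 0)) {ε : ℝ} (hε : 0 < ε)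
    (h : ∀ N, ∃ n ≥ N, ∃ m, ε ≤ |a n m|) :
    ∃ n m : ℕ → ℕ, StrictMono n ∧ StrictMono m ∧ ∀ i, ε ≤ |a (n i) (m i)| := by
  -- Far out in `n`, the finitely many columns `m < M` are all below `ε`, so a large entry must have
  -- `m ≥ M`.
  have step : ∀ M, ∃ n ≥ M, ∃ m ≥ M, ε ≤ |a n m| := fun M => by
    have h1 : ∀ᶠ n in atTop, ∀ m ∈ Finset.range M, |a n m| < ε :=
      (Filter.eventually_all_finset _).2 fun m _ => by
        have := (ha m).abs
        rw [abs_zero] at this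
        exact this.eventually_lt_const hε
    obtain ⟨N, hN⟩ := eventually_atTop.1 h1
    obtain ⟨n, hn, m, hm⟩ := h (max N M)
    refine ⟨n, (le_max_right _ _).trans hn, m, ?_, hm⟩
    by_contra hmM
    exact absurd (hN n ((le_max_left _ _).trans hn) m (Finset.mem_range.2 (not_le.1 hmM)))
      (not_lt.2 hm)
  obtain ⟨q, hq, hlt⟩ := exists_seq_of_forall_finset_exists
    (fun p : ℕ × ℕ => ε ≤ |a p.1 p.2|) (fun p q => p.1 < q.1 ∧ p.2 < q.2) fun s _ => by
      obtain ⟨n, hn, m, hm, hnm⟩ := step (s.sup (fun p => max p.1 p.2) + 1)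
      refine ⟨(n, m), hnm, fun p hp => ?_⟩
      have := Finset.le_sup (f := fun p : ℕ × ℕ => max p.1 p.2) hp
      simp only at this ⊢
      omega
  exact ⟨fun i => (q i).1, fun i => (q i).2, fun i j hij => (hlt i j hij).1,
    fun i j hij => (hlt i j hij).2, hq⟩

theorem isDunfordPettisSet_range_of_isDisjointSeq {E : Type*} [NormedAddCommGroup E]
    [NormedSpace ℝ E] [Lattice E] [IsOrderedAddMonoid E] [HasSolidNorm E] {x : ℕ → E}
    (hdisj : IsDisjointSeq x) (hx : IsAlmostDunfordPettisSet (Set.range x)) :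
    IsDunfordPettisSet (Set.range x) := by
  refine ⟨hx.1, fun f hf => ?_⟩
  by_contra hcon
  obtain ⟨ε, hε, h⟩ : ∃ ε > 0, ∀ N, ∃ n ≥ N, ∃ m, ε ≤ |f n (x m)| := by
    rw [ConvergesUniformlyToZeroOn, Metric.tendstoUniformlyOn_iff] at hcon
    simpa [Real.dist_eq, Filter.frequently_atTop] using hcon
  have hpt : ∀ m, Tendsto (fun n => f n (x m)) atTop (𝓝 0) := fun m =>
    (isWeaklyNull_iff f).1 hf (NormedSpace.inclusionInDoubleDual ℝ E (x m))
  obtain ⟨n, m, hn, hm, hnm⟩ :=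
    exists_strictMono_of_not_tendstoUniformly (a := fun n m => f n (x m)) hpt hε h
  have hxm : IsDisjointSeq fun i => x (m i) := fun i j hij =>
    hdisj _ _ (hm.injective.ne hij)
  have hfn : IsWeaklyNull fun i => f (n i) := (isWeaklyNull_iff _).2 fun φ =>
    ((isWeaklyNull_iff f).1 hf φ).comp hn.tendsto_atTop
  have key := hx.2 (fun i => bandProj (x (m i)) (f (n i)))
    (fun i j hij => dualDisjoint_bandProj (hxm i j hij) _ _) (isWeaklyNull_bandProj hxm hfn)
  obtain ⟨i, hi⟩ := (Metric.tendstoUniformlyOn_iff.1 key ε hε).exists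
  have := hi (x (m i)) ⟨m i, rfl⟩
  rw [bandProj_apply_self, dist_zero_left, Real.norm_eq_abs] at this
  exact absurd this (not_lt.2 (hnm i))

/-! ### Weakly compact operators into `c₀` -/

section ZeroAtInfty

theorem abs_apply_le_norm (f : C₀(ℕ, ℝ)) (k : ℕ) : |f k| ≤ ‖f‖ := by
  rw [← ZeroAtInftyContinuousMap.norm_toBCF_eq_norm]
  exact f.toBCF.norm_coe_le_norm k

/-- The coordinate functionals on `c₀`. -/
noncomputable def coordCLM (k : ℕ) : StrongDual ℝ C₀(ℕ, ℝ) :=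
  LinearMap.mkContinuous
    { toFun := fun f => f k
      map_add' := fun _ _ => rfl
      map_smul' := fun _ _ => rfl } 1 fun f => by simpa using abs_apply_le_norm f k

theorem coordCLM_apply (k : ℕ) (f : C₀(ℕ, ℝ)) : coordCLM k f = f k := rfl

theorem continuous_coord_weakSpace :
    Continuous fun (y : WeakSpace ℝ C₀(ℕ, ℝ)) (k : ℕ) => ((toWeakSpace ℝ _).symm y : C₀(ℕ, ℝ)) k :=
  continuous_pi fun k => WeakBilin.eval_continuous (topDualPairing ℝ C₀(ℕ, ℝ)).flip (coordCLM k)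

variable {X : Type*} [NormedAddCommGroup X] [NormedSpace ℝ X]

/-- A form of Goldstine's theorem, by Hahn–Banach in `ℕ → ℝ`: a separating functional uses finitely
many coordinates, so it pulls back to some `h` in the dual of `X` with `φ h > u ≥ ‖h‖`. -/
theorem coord_mem_closure_image_closedBall (T : X →L[ℝ] C₀(ℕ, ℝ))
    (φ : StrongDual ℝ (StrongDual ℝ X)) (hφ : ‖φ‖ ≤ 1) :
    (fun k => φ ((coordCLM k).comp T)) ∈
      closure ((fun (x : X) (k : ℕ) => T x k) '' Metric.closedBall 0 1) := by
  let R : X →ₗ[ℝ] (ℕ → ℝ) := LinearMap.pi fun k => ((coordCLM k).comp T).toLinearMap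
  have hconv : Convex ℝ ((fun (x : X) (k : ℕ) => T x k) '' Metric.closedBall 0 1) :=
    (convex_closedBall (0 : X) 1).linear_image R
  by_contra hnot
  obtain ⟨g, u, hu, hgu⟩ := geometric_hahn_banach_closed_point hconv.closure isClosed_closure hnot
  obtain ⟨I, hI⟩ := exists_finset_forall_strongDual_pi g
  let h : StrongDual ℝ X := ∑ i ∈ I, g (Pi.single i 1) • (coordCLM i).comp T
  have hgh : ∀ x, g (fun k => T x k) = h x := fun x => by
    simp [hI (fun k => T x k), h, sum_apply, coordCLM_apply, mul_comm]
  have hφh : g (fun k => φ ((coordCLM k).comp T)) = φ h := by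
    rw [hI]; simp [h, mul_comm]
  have hlt : ∀ x ∈ Metric.closedBall (0 : X) 1, h x < u := fun x hx => by
    rw [← hgh]; exact hu _ (subset_closure ⟨x, hx, rfl⟩)
  have hu0 : 0 ≤ u := by simpa using (hlt 0 (by simp)).le
  have hnorm : ‖h‖ ≤ u := by
    refine h.opNorm_le_of_unit_norm hu0 fun x hx => ?_
    refine abs_le'.2 ⟨(hlt x (by simp [hx])).le, ?_⟩
    rw [← map_neg]
    exact (hlt (-x) (by simp [hx])).le
  rw [hφh] at hgu
  have := (le_abs_self _).trans (φ.le_opNorm h)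
  have h2 : ‖φ‖ * ‖h‖ ≤ 1 * ‖h‖ := mul_le_mul_of_nonneg_right hφ (norm_nonneg h)
  linarith

theorem isWeaklyNull_coordCLM_comp {T : X →L[ℝ] C₀(ℕ, ℝ)} (hT : IsWeaklyCompactOperator T) :
    IsWeaklyNull fun k => (coordCLM k).comp T := by
  rw [isWeaklyNull_iff]
  have main : ∀ φ : StrongDual ℝ (StrongDual ℝ X), ‖φ‖ ≤ 1 →
      Tendsto (fun k => φ ((coordCLM k).comp T)) atTop (𝓝 0) := fun φ hφ => by
    -- Weak compactness makes the coordinate image closed in `ℕ → ℝ`, so the limit sequence given by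
    -- `φ` is still an element of `c₀`.
    have hK := (hT.image continuous_coord_weakSpace).isClosed
    have hsub : (fun (x : X) (k : ℕ) => T x k) '' Metric.closedBall 0 1 ⊆
        (fun (y : WeakSpace ℝ C₀(ℕ, ℝ)) (k : ℕ) => ((toWeakSpace ℝ _).symm y : C₀(ℕ, ℝ)) k) ''
          closure (toWeakSpace ℝ C₀(ℕ, ℝ) '' (T '' Metric.closedBall (0 : X) 1)) := by
      rintro _ ⟨x, hx, rfl⟩
      exact ⟨_, subset_closure ⟨_, ⟨x, hx, rfl⟩, rfl⟩, rfl⟩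
    obtain ⟨y, -, hy⟩ := closure_minimal hsub hK (coord_mem_closure_image_closedBall T φ hφ)
    have h0 := zero_at_infty ((toWeakSpace ℝ _).symm y : C₀(ℕ, ℝ))
    rw [cocompact_eq_cofinite, Nat.cofinite_eq_atTop] at h0
    exact h0.congr fun k => congrFun hy k
  intro φ
  have hpos : 0 < ‖φ‖ + 1 := by positivity
  have h1 := (main ((‖φ‖ + 1)⁻¹ • φ) (by
    refine (ContinuousLinearMap.opNorm_smul_le _ φ).trans ?_
    rw [norm_inv, Real.norm_of_nonneg hpos.le, inv_mul_le_one₀ hpos]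
    linarith)).const_mul (‖φ‖ + 1)
  rw [mul_zero] at h1
  refine h1.congr fun k => ?_
  rw [smul_apply, smul_eq_mul, mul_inv_cancel_left₀ hpos.ne']

/-- The tails are uniformly small, so the first `N` coordinates determine an element up to `ε`, and
these range over a bounded subset of a finite-dimensional space. -/
theorem totallyBounded_of_uniform_zeroAtInfty {A : Set C₀(ℕ, ℝ)} (hA : Bornology.IsBounded A)
    (h : ∀ ε > 0, ∃ N, ∀ k ≥ N, ∀ f ∈ A, |f k| < ε) : TotallyBounded A := by
  refine Metric.totallyBounded_of_finite_discretization fun ε hε => ?_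
  obtain ⟨N, hN⟩ := h (ε / 8) (by positivity)
  obtain ⟨C, hC⟩ := hA.exists_norm_le
  let R : C₀(ℕ, ℝ) → Fin N → ℝ := fun f i => f i
  have hR : TotallyBounded (R '' A) := by
    refine ((isCompact_closedBall (0 : Fin N → ℝ) |C|).totallyBounded).subset ?_
    rintro _ ⟨f, hf, rfl⟩
    rw [mem_closedBall_zero_iff, pi_norm_le_iff_of_nonneg (abs_nonneg C)]
    exact fun i => (abs_apply_le_norm f i).trans ((hC f hf).trans (le_abs_self C))
  obtain ⟨t, ht, hcov⟩ := Metric.totallyBounded_iff.1 hR (ε / 4) (by positivity)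
  have hex : ∀ f : A, ∃ c : t, dist (R f) c < ε / 4 := fun f => by
    obtain ⟨c, hc, hfc⟩ := Set.mem_iUnion₂.1 (hcov ⟨f, f.2, rfl⟩)
    exact ⟨⟨c, hc⟩, hfc⟩
  choose F hF using hex
  have := ht.fintype
  refine ⟨ULift t, inferInstance, fun f => ⟨F f⟩, fun f g hfg => ?_⟩
  have hfg' : F f = F g := congrArg ULift.down hfg
  have hd : dist (R f) (R g) < ε / 2 := by
    have h1 := hF f
    rw [hfg'] at h1
    linarith [dist_triangle_right (R f) (R g) (F g), hF g]
  refine lt_of_le_of_lt ?_ (half_lt_self hε)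
  rw [← ZeroAtInftyContinuousMap.dist_toBCF_eq_dist,
    BoundedContinuousFunction.dist_le (by positivity)]
  intro k
  change dist ((f : C₀(ℕ, ℝ)) k) ((g : C₀(ℕ, ℝ)) k) ≤ ε / 2
  by_cases hk : k < N
  · exact (dist_le_pi_dist (R f) (R g) ⟨k, hk⟩).trans hd.le
  · have h1 := abs_lt.1 (hN k (not_lt.1 hk) f f.2)
    have h2 := abs_lt.1 (hN k (not_lt.1 hk) g g.2)
    rw [Real.dist_eq, abs_le]
    constructor <;> linarith

theorem isCompact_closure_image_of_isDunfordPettisSet {A : Set X} (hA : IsDunfordPettisSet A)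
    {T : X →L[ℝ] C₀(ℕ, ℝ)} (hT : IsWeaklyCompactOperator T) : IsCompact (closure (T '' A)) := by
  refine (totallyBounded_of_uniform_zeroAtInfty (T.lipschitz.isBounded_image hA.1)
    fun ε hε => ?_).closure.isCompact_of_isClosed isClosed_closure
  have := Metric.tendstoUniformlyOn_iff.1 (hA.2 _ (isWeaklyNull_coordCLM_comp hT)) ε hε
  obtain ⟨N, hN⟩ := eventually_atTop.1 this
  refine ⟨N, fun k hk => ?_⟩
  rintro _ ⟨x, hx, rfl⟩
  have := hN k hk x hx
  rwa [dist_zero_left] at this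

end ZeroAtInfty

theorem mainTheorem11 {E : Type*} [NormedAddCommGroup E] [NormedSpace ℝ E] [Lattice E]
    [IsOrderedAddMonoid E] [IsOrderedModule ℝ E] [HasSolidNorm E] [CompleteSpace E]
    (x : ℕ → E) (hdisj : IsDisjointSeq x) (hx : IsAlmostDunfordPettisSet (Set.range x)) :
    IsDunfordPettisSet (Set.range x) ∧
      ∀ T : E →L[ℝ] C₀(ℕ, ℝ), IsWeaklyCompactOperator T →
        IsCompact (closure (T '' Set.range x)) := by
  have h := isDunfordPettisSet_range_of_isDisjointSeq hdisj hx
  exact ⟨h, fun _ hT => isCompact_closure_image_of_isDunfordPettisSet h hT⟩
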